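/- Let $\Gamma$ be a finite graph without loops (multiple edges are allowed) with set of edges $E$. A \emph{dimer covering} of $\Gamma$ is a set $A\subset E$ such that every vertex $v$ of $\Gamma$ is incident to exactly one edge $A_v$ of $A$; let $\mathcal{D}$ be the set of dimer coverings. A triple $A,B,C\in\mathcal{D}$ is \emph{flat} if for every vertex $v$ at least two of the edges $A_v,B_v,C_v$ coincide. A \emph{cycle} is a non-empty set $s\subset E$ whose edges form a single embedded circle in $\Gamma$; it is \emph{even} if $|s|$ is even. Two cycles are \emph{independent} if the edges of one have no common vertices with the edges of the other. For a set $T$ of pairwise independent even cycles and $A\subset E$, let $[T]A$ be the symmetric difference of $\bigcup_{t\in T}t$ and $A$. Let $X_{\mathcal{D}}$ be the \emph{dimer complex} of $\Gamma$: the quotient of the disjoint union of the cubes $[0,1]^S$, over all pairs $(A,S)$ where $A\subset E$ and $S$ is a finite set of pairwise independent even cycles such that $[T]A\in\mathcal{D}$ for all $T\subset S$, by the equivalence relation on the triples $(A,S,x)$, $x\in[0,1]^S$, generated by \begin{itemize} \item $(A,S,x)\sim(A,S',x')$ if $S\subset S'$, $x=x'|_S$ and $x'=0$ on $S'\setminus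 S$; \item $(A,S,x)\sim([T]A,S,x')$ if $T\subset S$, $x'=1-x$ on $T$ and $x'=x$ on $S\setminus T$. \end{itemize} Each $A\in\mathcal{D}$ is a point (a $0$-cell) of $X_{\mathcal{D}}$, represented by $(A,\emptyset)$. \textbf{Theorem.} For every $A_0\in\mathcal{D}$, the dimer group $\pi_1(X_{\mathcal{D}},A_0)$ is isomorphic to the group with generators $\{y_{A,B}\}_{A,B\in\mathcal{D}}$ subject to the defining relations $y_{A,C}=y_{A,B}\,y_{B,C}$ for every flat triple $A,B,C\in\mathcal{D}$ and $y_{A_0,A}=1$ for all $A\in\mathcal{D}$. -/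

import Mathlib

open scoped Graph symmDiff unitInterval

namespace DimerGroup

universe u v

variable {α : Type u} {β : Type v}

/-! ### Dimer coverings -/

/-- A dimer covering (perfect matching) of a multigraph: a set of edges such that every vertex is
incident to exactly one edge of the set. -/
structure IsDimerCovering (Γ : Graph α β) (A : Set β) : Prop where
  subset_edgeSet : A ⊆ E(Γ)
  existsUnique_inc : ∀ w ∈ V(Γ), ∃! e, e ∈ A ∧ Γ.Inc e w

/-- The set `𝒟` of all dimer coverings. -/
def dimerCoverings (Γ : Graph α β) : Set (Set β) := {A | IsDimerCovering Γ A}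

/-- The edge `A_w`: the only edge of the dimer covering `A` incident to the vertex `w`. -/
noncomputable def edgeAt {Γ : Graph α β} (A : dimerCoverings Γ) (w : V(Γ)) : β :=
  (A.2.existsUnique_inc w w.2).choose

/-- A triple of dimer coverings is flat if at every vertex `w` at least two of the edges
`A_w`, `B_w`, `C_w` coincide. -/
def IsFlat {Γ : Graph α β} (A B C : dimerCoverings Γ) : Prop :=
  ∀ w : V(Γ), edgeAt A w = edgeAt B w ∨ edgeAt A w = edgeAt C w ∨ edgeAt B w = edgeAt C w

/-! ### Even cycles and their independence -/

/-- A finite set of edges is cyclic if every vertex is incident either to exactly two edges of the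
set or to none of them. -/
structure IsCyclicSet (Γ : Graph α β) (s : Set β) : Prop where
  subset_edgeSet : s ⊆ E(Γ)
  finite : s.Finite
  inc : ∀ w ∈ V(Γ), {e | e ∈ s ∧ Γ.Inc e w}.encard = 2 ∨ {e | e ∈ s ∧ Γ.Inc e w} = ∅

/-- The edges `e` and `f` belong to `s` and share a vertex. -/
def Touch (Γ : Graph α β) (s : Set β) (e f : β) : Prop :=
  e ∈ s ∧ f ∈ s ∧ ∃ w, Γ.Inc e w ∧ Γ.Inc f w

/-- A cyclic set is a cycle if the union of its edges (a disjoint union of circles) is a single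
circle, that is, if this union is non-empty and connected. -/
structure IsCycle (Γ : Graph α β) (s : Set β) : Prop extends IsCyclicSet Γ s where
  nonempty : s.Nonempty
  connected : ∀ e ∈ s, ∀ f ∈ s, Relation.ReflTransGen (Touch Γ s) e f

/-- The glides: the cycles with an even number of edges. -/
structure IsEvenCycle (Γ : Graph α β) (s : Set β) : Prop extends IsCycle Γ s where
  even : Even s.ncard

/-- Two sets of edges are independent if no edge of one shares a vertex with an edge of the
other. -/
def Independent (Γ : Graph α β) (s t : Set β) : Prop :=
  ∀ e ∈ s, ∀ f ∈ t, ∀ w, ¬ (Γ.Inc e w ∧ Γ.Inc f w)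

/-! ### The cubed complex of a family of sets of edges

The sets of edges form a group under the symmetric difference `∆`, in which every element is its own
inverse. Gliding a set `A` along an even cycle `s` gives `s ∆ A`. As independent even cycles are
pairwise disjoint, the product `[T]` of a set `T` of independent even cycles is the
union `⋃₀ T`. -/

/-- A based cube `(A, S)` all of whose vertices `[T] A`, `T ⊆ S`, belong to `𝓔`. -/
structure BasedCube (Γ : Graph α β) (𝓔 : Set (Set β)) where
  base : Set β
  glides : Set (Set β)
  finite : glides.Finite
  isEvenCycle : ∀ s ∈ glides, IsEvenCycle Γ s
  independent : glides.Pairwise (Independent Γ)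
  vertex_mem : ∀ T ⊆ glides, (⋃₀ T) ∆ base ∈ 𝓔

/-- Distinct sets of glides of a based cube have distinct products, so that its set of glides is
cubic and its vertices are pairwise distinct. -/
theorem BasedCube.sUnion_inj {Γ : Graph α β} {𝓔 : Set (Set β)} (c : BasedCube Γ 𝓔)
    {T₁ T₂ : Set (Set β)} (h₁ : T₁ ⊆ c.glides) (h₂ : T₂ ⊆ c.glides) (h : ⋃₀ T₁ = ⋃₀ T₂) :
    T₁ = T₂ := by
  have key : ∀ {T T' : Set (Set β)}, T ⊆ c.glides → T' ⊆ c.glides → ⋃₀ T = ⋃₀ T' → T ⊆ T' := by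
    intro T T' hT hT' hU s hs
    obtain ⟨e, he⟩ := (c.isEvenCycle s (hT hs)).nonempty
    have he' : e ∈ ⋃₀ T' := hU ▸ Set.mem_sUnion_of_mem he hs
    obtain ⟨t, ht, het⟩ := he'
    by_cases hst : s = t
    · exact hst ▸ ht
    · obtain ⟨x, y, hxy⟩ := Graph.exists_isLink_of_mem_edgeSet
        ((c.isEvenCycle s (hT hs)).subset_edgeSet he)
      exact absurd ⟨hxy.inc_left, hxy.inc_left⟩
        (c.independent (hT hs) (hT' ht) hst e he e het x)
  exact (key h₁ h₂ h).antisymm (key h₂ h₁ h.symm)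

/-- The disjoint union of the geometric cubes `I ^ S` over all based cubes `(A, S)` in `𝓔`; a point
is a triple `(A, S, x)` with `x : S → I`. It carries the disjoint union topology. -/
abbrev CubePoint (Γ : Graph α β) (𝓔 : Set (Set β)) : Type v :=
  Σ c : BasedCube Γ 𝓔, (c.glides → I)

/-- `(A, S, x) ∼ (A, S', x')` when `S ⊆ S'`, `x` is the restriction of `x'` to `S`, and `x'` is zero
on `S' \ S`. -/
def FaceRel {Γ : Graph α β} {𝓔 : Set (Set β)} (p q : CubePoint Γ 𝓔) : Prop :=
  p.1.base = q.1.base ∧ ∃ h : p.1.glides ⊆ q.1.glides,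
    (∀ s : p.1.glides, p.2 s = q.2 ⟨s, h s.2⟩) ∧
      ∀ s : q.1.glides, (s : Set β) ∉ p.1.glides → q.2 s = 0

/-- `(A, S, x) ∼ ([T] A, S, x')` when `T ⊆ S`, `x' = 1 - x` on `T`, and `x' = x` on `S \ T`
(recall that every glide is its own inverse). -/
def FlipRel {Γ : Graph α β} {𝓔 : Set (Set β)} (p q : CubePoint Γ 𝓔) : Prop :=
  ∃ T ⊆ p.1.glides, q.1.base = (⋃₀ T) ∆ p.1.base ∧ ∃ h : p.1.glides = q.1.glides,
    ∀ s : p.1.glides,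
      ((s : Set β) ∈ T → q.2 ⟨s, h ▸ s.2⟩ = σ (p.2 s)) ∧
        ((s : Set β) ∉ T → q.2 ⟨s, h ▸ s.2⟩ = p.2 s)

/-- The cubed complex `X_𝓔` glued from the cubes whose vertices lie in `𝓔`: the quotient of the
disjoint union of geometric cubes by the equivalence relation generated by `FaceRel` and `FlipRel`,
with the quotient topology. -/
abbrev CubedComplex (Γ : Graph α β) (𝓔 : Set (Set β)) : Type v :=
  Quot fun p q : CubePoint Γ 𝓔 => FaceRel p q ∨ FlipRel p q

/-- The zero-dimensional based cube with the only vertex `A`. -/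
def BasedCube.point (Γ : Graph α β) {𝓔 : Set (Set β)} (A : 𝓔) : BasedCube Γ 𝓔 where
  base := A
  glides := ∅
  finite := Set.finite_empty
  isEvenCycle := fun _ h => h.elim
  independent := Set.pairwise_empty _
  vertex_mem := fun T hT => by
    rw [Set.subset_empty_iff.1 hT, Set.sUnion_empty, ← Set.bot_eq_empty, bot_symmDiff]
    exact A.2

/-- The `0`-cell of `X_𝓔` given by an element of `𝓔`. -/
def CubedComplex.vertex (Γ : Graph α β) {𝓔 : Set (Set β)} (A : 𝓔) : CubedComplex Γ 𝓔 :=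
  Quot.mk _ ⟨BasedCube.point Γ A, fun s => s.2.elim⟩

/-- The dimer complex `X_𝒟`. -/
abbrev DimerComplex (Γ : Graph α β) : Type v := CubedComplex Γ (dimerCoverings Γ)

/-! ### The presented group -/

/-- The relators for the generators `y (A, B)`, with `A` and `B` dimer coverings: those of the
relations `y (A, C) = y (A, B) * y (B, C)` for flat triples and `y (A₀, A) = 1`. -/
def relators {Γ : Graph α β} (A₀ : dimerCoverings Γ) :
    Set (FreeGroup (dimerCoverings Γ × dimerCoverings Γ)) :=
  {r | ∃ A B C : dimerCoverings Γ, IsFlat A B C ∧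
      r = (FreeGroup.of (A, C))⁻¹ * (FreeGroup.of (A, B) * FreeGroup.of (B, C))} ∪
    {r | ∃ A : dimerCoverings Γ, r = FreeGroup.of (A₀, A)}

end DimerGroup

/-!
The theorem is the nerve theorem for the fundamental group, applied to the cover of the dimer
complex `X` by the open stars of its vertices.

Let `U A` be the open star of the vertex `A`, that is, the set of the points represented by
`(A, S, x)` with all coordinates less than `1`.

* `U A` is open, and it contracts onto `A` within itself along the segments `(A, S, t * x)`
  (`continuousOn_starTrajectory`).
* Two dimer coverings `A`, `B` always span a cube: at each vertex of the graph `A ∆ B` has either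
  no edge or one edge of `A` and one of `B`, so its components are independent even cycles, and
  gliding `A` along all of them gives `B`. A cube with the vertices `A` and `B` has all these
  cycles among its glides, as a set of edges is in at most one way a union of independent cycles
  (`subset_of_sUnion_eq`). So `U A ∩ U B` is the open star of the cube spanned by `A` and `B`, and
  it is path-connected (`isPathConnected_inter_openStar`).
* `U A`, `U B` and `U C` have a common point if and only if `A`, `B`, `C` are vertices of one cube,
  and this holds if and only if the triple is flat (`nonempty_inter_openStar_iff`): the glides of a
  cube pass through disjoint sets of vertices of the graph, and conversely the components of
  `A ∆ B ∪ A ∆ C` are the glides of a cube for a flat triple.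

For such a cover of any space, the group `G` with generators `y (i, j)` and relations
`y (i, k) = y (i, j) * y (j, k)` for triples with a common point, and `y (i₀, i) = 1`, is the
fundamental group (`ContractibleCover.fundamentalGroupEquiv`). The generators go to
the loops through the centers of the members of the cover. This homomorphism is onto because a path is locally contained in one
member, and a path in one member is determined up to homotopy by its endpoints
(`ContractibleCover.isGenerated`). It is injective because the defining relations of `G` are the
cocycle condition for a principal bundle with discrete fiber `G` and transition functions
`y (i, j)`; this bundle is a covering, and the monodromy of the image of `h` is the translation by
`h⁻¹` (`ContractibleCover.monodromy_toFundamentalGroup`). So no van Kampen theorem is needed.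
-/

/-! ### Covers by contractible sets -/

/-- An open cover of `X` by sets each of which contracts within itself onto a chosen point, its
center, and any two of which have a path-connected (in particular non-empty) intersection.
The contraction of a member is recorded as a function assigning to `x` its trajectory, a path from
the center to `x`; its values outside the member are irrelevant. -/
structure ContractibleCover (X : Type*) [TopologicalSpace X] (ι : Type*) where
  carrier : ι → Set X
  isOpen : ∀ i, IsOpen (carrier i)
  exists_mem : ∀ x, ∃ i, x ∈ carrier i
  center : ι → X
  contraction : ι → X → C(I, X)
  continuousOn_contraction : ∀ i, ContinuousOn (contraction i) (carrier i)
  contraction_zero : ∀ i, ∀ x ∈ carrier i, contraction i x 0 = center i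
  contraction_one : ∀ i, ∀ x ∈ carrier i, contraction i x 1 = x
  contraction_mem : ∀ i, ∀ x ∈ carrier i, ∀ t, contraction i x t ∈ carrier i
  isPathConnected_inter : ∀ i j, IsPathConnected (carrier i ∩ carrier j)

namespace ContractibleCover

open CategoryTheory Topology

variable {X ι : Type*} [TopologicalSpace X] (V : ContractibleCover X ι) {i j k : ι} {x y : X}

theorem center_mem (i : ι) : V.center i ∈ V.carrier i := by
  obtain ⟨x, hx, -⟩ := (V.isPathConnected_inter i i).nonempty
  exact V.contraction_zero i x hx ▸ V.contraction_mem i x hx 0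

/-- The class of a path, as a morphism of the fundamental groupoid. -/
abbrev pathClass (γ : Path x y) : FundamentalGroupoid.mk x ⟶ FundamentalGroupoid.mk y :=
  Path.Homotopic.Quotient.mk γ

/-- The path from the center of a member of the cover to `x` given by the contraction. -/
def rayPath (hx : x ∈ V.carrier i) : Path (V.center i) x where
  toContinuousMap := V.contraction i x
  source' := V.contraction_zero i x hx
  target' := V.contraction_one i x hx

/-- The homotopy class of `rayPath`. -/
def ray (hx : x ∈ V.carrier i) :
    FundamentalGroupoid.mk (V.center i) ⟶ FundamentalGroupoid.mk x :=
  pathClass (V.rayPath hx)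

/-- The contraction, applied along a path which stays in one member of the cover, gives a homotopy
between the two rays to its endpoints. -/
theorem ray_comp (hx : x ∈ V.carrier i) (hy : y ∈ V.carrier i) (γ : Path x y)
    (hγ : ∀ t, γ t ∈ V.carrier i) : V.ray hx ≫ pathClass γ = V.ray hy := by
  have : ContractibleSpace I := (convex_Icc (0 : ℝ) 1).contractibleSpace ⟨0, by simp⟩
  have hf : Continuous fun p : I × I => V.contraction i (γ p.1) p.2 := by
    have h : Continuous fun s : I => V.contraction i (γ s) :=
      (V.continuousOn_contraction i).comp_continuous γ.continuous hγ
    exact ContinuousEval.continuous_eval.comp (h.prodMap continuous_id)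
  -- The two ways around the boundary of the square are homotopic; the homotopy is mapped to `X`.
  let a : Path ((0, 0) : I × I) (0, 1) :=
    { toFun := fun t => (0, t), source' := rfl, target' := rfl }
  let b : Path ((0, 1) : I × I) (1, 1) :=
    { toFun := fun t => (t, 1), source' := rfl, target' := rfl }
  let c : Path ((0, 0) : I × I) (1, 0) :=
    { toFun := fun t => (t, 0), source' := rfl, target' := rfl }
  let d : Path ((1, 0) : I × I) (1, 1) :=
    { toFun := fun t => (1, t), source' := rfl, target' := rfl }
  have e₀ : V.center i = V.contraction i (γ 0) 0 := (V.contraction_zero i _ (hγ 0)).symm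
  have e₁ : y = V.contraction i (γ 1) 1 := by
    rw [V.contraction_one i _ (hγ 1), γ.target]
  have key := (((SimplyConnectedSpace.paths_homotopic (a.trans b) (c.trans d)).map
    ⟨_, hf⟩).pathCast e₀ e₁)
  have h₁ : ((a.trans b).map hf).cast e₀ e₁ = (V.rayPath hx).trans γ := by
    ext t
    simp only [Path.cast_coe, Path.map_coe, Function.comp_apply, Path.trans_apply]
    split_ifs
    · change V.contraction i (γ 0) _ = V.contraction i x _
      rw [γ.source]
      rfl
    · exact V.contraction_one i _ (hγ _)
  have h₂ : ((c.trans d).map hf).cast e₀ e₁ = (Path.refl _).trans (V.rayPath hy) := by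
    ext t
    simp only [Path.cast_coe, Path.map_coe, Function.comp_apply, Path.trans_apply]
    split_ifs
    · exact V.contraction_zero i _ (hγ _)
    · change V.contraction i (γ 1) _ = V.contraction i y _
      rw [γ.target]
      rfl
  refine Quotient.sound (Path.Homotopic.trans ?_ (Path.Homotopic.refl_trans (V.rayPath hy)))
  exact h₁ ▸ h₂ ▸ key

theorem pathClass_eq (hx : x ∈ V.carrier i) (hy : y ∈ V.carrier i) (γ : Path x y)
    (hγ : ∀ t, γ t ∈ V.carrier i) : pathClass γ = inv (V.ray hx) ≫ V.ray hy := by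
  rw [← V.ray_comp hx hy γ hγ, IsIso.inv_hom_id_assoc]

@[simp]
theorem ray_center (i : ι) : V.ray (V.center_mem i) = 𝟙 _ := by
  refine (V.pathClass_eq (V.center_mem i) (V.center_mem i)
    (V.rayPath (V.center_mem i)) fun t => V.contraction_mem i _ (V.center_mem i) t).trans ?_
  rw [IsIso.inv_hom_id]

/-- The class of the paths which run from the center of one member to the center of another through
a point of their intersection. -/
noncomputable def link (i j : ι) :
    FundamentalGroupoid.mk (V.center i) ⟶ FundamentalGroupoid.mk (V.center j) :=
  V.ray (V.isPathConnected_inter i j).nonempty.some_mem.1 ≫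
    inv (V.ray (V.isPathConnected_inter i j).nonempty.some_mem.2)

/-- The point of the intersection used in `link` is irrelevant, as the intersection is
path-connected. -/
theorem link_eq (hi : x ∈ V.carrier i) (hj : x ∈ V.carrier j) :
    V.link i j = V.ray hi ≫ inv (V.ray hj) := by
  have h := (V.isPathConnected_inter i j).nonempty.some_mem
  obtain ⟨γ, hγ⟩ := (V.isPathConnected_inter i j).joinedIn x ⟨hi, hj⟩ _ h
  simp [link, ← V.ray_comp hi h.1 γ fun t => (hγ t).1, ← V.ray_comp hj h.2 γ fun t => (hγ t).2]

theorem link_self (i : ι) : V.link i i = 𝟙 _ := by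
  rw [V.link_eq (V.center_mem i) (V.center_mem i), IsIso.hom_inv_id]

theorem link_comp_link (h : (V.carrier i ∩ V.carrier j ∩ V.carrier k).Nonempty) :
    V.link i j ≫ V.link j k = V.link i k := by
  obtain ⟨x, ⟨hi, hj⟩, hk⟩ := h
  rw [V.link_eq hi hj, V.link_eq hj hk, V.link_eq hi hk]
  simp

theorem link_comp_link_symm (i j : ι) : V.link i j ≫ V.link j i = 𝟙 _ := by
  obtain ⟨x, hi, hj⟩ := (V.isPathConnected_inter i j).nonempty
  rw [V.link_eq hi hj, V.link_eq hj hi]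
  simp

theorem link_cancel {z : X} (i j : ι)
    (f : FundamentalGroupoid.mk (V.center i) ⟶ FundamentalGroupoid.mk z) :
    V.link i j ≫ V.link j i ≫ f = f := by
  rw [← Category.assoc, link_comp_link_symm, Category.id_comp]

/-- The loop at the center of `i₀` which runs through the centers of `j` and `i`. -/
noncomputable def loop (i₀ i j : ι) : FundamentalGroup X (V.center i₀) :=
  V.link i₀ j ≫ V.link j i ≫ V.link i i₀

/-! ### The presentation of the fundamental group -/

/-- The relators of the group of the cover: the relations `y (i, k) = y (i, j) * y (j, k)` for
members with a common point, and `y (i₀, i) = 1`. -/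
def nerveRelators (i₀ : ι) : Set (FreeGroup (ι × ι)) :=
  {r | ∃ i j k : ι, (V.carrier i ∩ V.carrier j ∩ V.carrier k).Nonempty ∧
      r = (FreeGroup.of (i, k))⁻¹ * (FreeGroup.of (i, j) * FreeGroup.of (j, k))} ∪
    {r | ∃ i : ι, r = FreeGroup.of (i₀, i)}

variable (i₀ : ι)

/-- The generator `y (i, j)` of the group of the cover. -/
def gen (i j : ι) : PresentedGroup (V.nerveRelators i₀) := PresentedGroup.of (i, j)

theorem gen_mul_gen (h : (V.carrier i ∩ V.carrier j ∩ V.carrier k).Nonempty) :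
    V.gen i₀ i j * V.gen i₀ j k = V.gen i₀ i k :=
  (inv_mul_eq_one.1 (PresentedGroup.one_of_mem (Or.inl ⟨i, j, k, h, rfl⟩))).symm

theorem gen_base (i : ι) : V.gen i₀ i₀ i = 1 :=
  PresentedGroup.one_of_mem (Or.inr ⟨i, rfl⟩)

theorem gen_self (i : ι) : V.gen i₀ i i = 1 := by
  have h : (V.carrier i ∩ V.carrier i ∩ V.carrier i).Nonempty := by
    rw [Set.inter_self, Set.inter_self]
    exact ⟨_, V.center_mem i⟩
  simpa using V.gen_mul_gen i₀ h

theorem gen_base_right (i : ι) : V.gen i₀ i i₀ = 1 := by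
  obtain ⟨x, hi, hj⟩ := (V.isPathConnected_inter i₀ i).nonempty
  have h := V.gen_mul_gen i₀ ⟨x, ⟨hi, hj⟩, hi⟩
  rwa [gen_base, one_mul, gen_base] at h

/-- The homomorphism sending `y (i, j)` to the loop through the centers of `j` and `i`. The order is
reversed because the product `p * q` of the fundamental group is the path `q` followed by `p`. -/
noncomputable def toFundamentalGroup :
    PresentedGroup (V.nerveRelators i₀) →* FundamentalGroup X (V.center i₀) :=
  PresentedGroup.toGroup (f := fun p : ι × ι => V.loop i₀ p.1 p.2) <| by
    rintro r (⟨i, j, k, h, rfl⟩ | ⟨i, rfl⟩)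
    · have h' : (V.carrier k ∩ V.carrier j ∩ V.carrier i).Nonempty := by
        obtain ⟨x, ⟨hi, hj⟩, hk⟩ := h
        exact ⟨x, ⟨hk, hj⟩, hi⟩
      simp only [map_mul, map_inv, FreeGroup.lift_apply_of, inv_mul_eq_one]
      rw [End.mul_def]
      simp only [loop, Category.assoc]
      rw [link_cancel, ← V.link_comp_link h', Category.assoc]
    · simp only [FreeGroup.lift_apply_of, loop]
      rw [← Category.assoc, link_comp_link_symm, Category.id_comp, link_self]
      rfl

@[simp]
theorem toFundamentalGroup_gen (i j : ι) :
    V.toFundamentalGroup i₀ (V.gen i₀ i j) = V.loop i₀ i j :=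
  PresentedGroup.toGroup.of _

/-! ### Surjectivity: loops are products of loops through centers -/

/-- A path class is generated by the cover if, once its endpoints are joined to the base point
through the centers of members of the cover, it becomes the image of an element of the group of the
cover. -/
def IsGenerated (p : FundamentalGroupoid.mk x ⟶ FundamentalGroupoid.mk y) : Prop :=
  ∀ i j (hx : x ∈ V.carrier i) (hy : y ∈ V.carrier j),
    (V.link i₀ i ≫ V.ray hx ≫ p ≫ inv (V.ray hy) ≫ V.link j i₀ :
      FundamentalGroup X (V.center i₀)) ∈ (V.toFundamentalGroup i₀).range

variable {i₀}

theorem IsGenerated.comp {z : X} {p : FundamentalGroupoid.mk x ⟶ FundamentalGroupoid.mk y}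
    {q : FundamentalGroupoid.mk y ⟶ FundamentalGroupoid.mk z} (hp : V.IsGenerated i₀ p)
    (hq : V.IsGenerated i₀ q) : V.IsGenerated i₀ (p ≫ q) := by
  intro i j hx hz
  obtain ⟨k, hk⟩ := V.exists_mem y
  convert mul_mem (hq k j hk hz) (hp i k hx hk) using 1
  rw [End.mul_def]
  simp only [Category.assoc, link_cancel, IsIso.inv_hom_id_assoc]

theorem isGenerated_of_forall_mem (γ : Path x y) (hγ : ∀ t, γ t ∈ V.carrier k) :
    V.IsGenerated i₀ (pathClass γ) := by
  intro i j hx hy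
  have hxk : x ∈ V.carrier k := by simpa using hγ 0
  have hyk : y ∈ V.carrier k := by simpa using hγ 1
  refine ⟨V.gen i₀ j k * V.gen i₀ k i, ?_⟩
  rw [map_mul, toFundamentalGroup_gen, toFundamentalGroup_gen, End.mul_def, loop, loop,
    V.pathClass_eq hxk hyk γ hγ, V.link_eq hx hxk, V.link_eq hyk hy]
  simp only [Category.assoc, link_cancel]

/-- Every path class is generated by the cover: the set of times up to which the path is
generated is open and closed, because close to any time the path stays in one member of
the cover. -/
theorem isGenerated (p : FundamentalGroupoid.mk x ⟶ FundamentalGroupoid.mk y) :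
    V.IsGenerated i₀ p := by
  have : ContractibleSpace I := (convex_Icc (0 : ℝ) 1).contractibleSpace ⟨0, by simp⟩
  obtain ⟨γ, rfl⟩ : ∃ γ : Path x y, pathClass γ = p :=
    Path.Homotopic.Quotient.mk_surjective p
  obtain ⟨f, rfl, rfl⟩ := γ
  have : LocallyPathConnectedSpace I := (convex_Icc (0 : ℝ) 1).locallyPathConnectedSpace
  have hsub (s t : I) : Subsingleton (FundamentalGroupoid.mk s ⟶ FundamentalGroupoid.mk t) :=
    inferInstanceAs (Subsingleton (Path.Homotopic.Quotient s t))
  -- `I` is simply connected, so the restriction of the path to the interval from `s` to `t` is the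
  -- image `δ s t` of the only class of paths from `s` to `t` in `I`, for `s` and `t` in any order.
  let seg (s t : I) : FundamentalGroupoid.mk s ⟶ FundamentalGroupoid.mk t :=
    pathClass (PathConnectedSpace.somePath s t)
  let δ (s t : I) : FundamentalGroupoid.mk (f s) ⟶ FundamentalGroupoid.mk (f t) :=
    (FundamentalGroupoid.map f).map (seg s t)
  have hδ (s t : I) (γ : Path s t) : δ s t = pathClass (γ.map f.continuous) :=
    congrArg (FundamentalGroupoid.map f).map ((hsub s t).elim (seg s t) (pathClass γ))
  have hcomp (r s t : I) : δ r s ≫ δ s t = δ r t :=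
    ((FundamentalGroupoid.map f).map_comp (seg r s) (seg s t)).symm.trans
      (congrArg (FundamentalGroupoid.map f).map ((hsub r t).elim _ _))
  have hloc : IsLocallyConstant fun t : I => V.IsGenerated i₀ (δ 0 t) := by
    rw [IsLocallyConstant.iff_eventually_eq]
    intro t
    obtain ⟨k, hk⟩ := V.exists_mem (f t)
    have hW : f ⁻¹' V.carrier k ∈ 𝓝 t := ((V.isOpen k).preimage f.continuous).mem_nhds hk
    obtain ⟨N, ⟨hN, hNc⟩, hNW⟩ := (path_connected_basis t).mem_iff.1 hW
    filter_upwards [hN] with s hs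
    have aux (a b : I) (ha : a ∈ N) (hb : b ∈ N) (h : V.IsGenerated i₀ (δ 0 a)) :
        V.IsGenerated i₀ (δ 0 b) := by
      obtain ⟨γ, hγ⟩ := hNc.joinedIn a ha b hb
      rw [← hcomp 0 a b]
      refine h.comp V ?_
      rw [hδ a b γ]
      exact V.isGenerated_of_forall_mem _ fun u => hNW (hγ u)
    exact propext ⟨aux s t hs (mem_of_mem_nhds hN), aux t s (mem_of_mem_nhds hN) hs⟩
  have h₀ : V.IsGenerated i₀ (δ 0 0) := by
    obtain ⟨k, hk⟩ := V.exists_mem (f 0)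
    rw [hδ 0 0 (Path.refl 0)]
    exact V.isGenerated_of_forall_mem _ fun _ => hk
  have h₁ : V.IsGenerated i₀ (δ 0 1) :=
    (hloc.apply_eq_of_isPreconnected isPreconnected_univ (Set.mem_univ 0) (Set.mem_univ 1)).mp h₀
  rw [hδ 0 1 ⟨ContinuousMap.id I, rfl, rfl⟩] at h₁
  exact h₁

theorem toFundamentalGroup_surjective : Function.Surjective (V.toFundamentalGroup i₀) := by
  intro p
  have h := V.isGenerated (i₀ := i₀) p i₀ i₀ (V.center_mem i₀) (V.center_mem i₀)
  simp only [link_self, ray_center, IsIso.inv_id] at h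
  simpa using h

/-! ### Injectivity: the covering with the group of the cover as fiber -/

variable (i₀)

/-- The group of the cover is given the discrete topology, as the fiber of a covering. -/
instance : TopologicalSpace (PresentedGroup (V.nerveRelators i₀)) := ⊥

instance : DiscreteTopology (PresentedGroup (V.nerveRelators i₀)) := ⟨rfl⟩

/-- The bundle with fiber the group of the cover and transition functions the right translations by
the generators. The defining relations are exactly its cocycle condition. -/
noncomputable def bundle : FiberBundleCore ι X (PresentedGroup (V.nerveRelators i₀)) where
  baseSet := V.carrier
  isOpen_baseSet := V.isOpen
  indexAt x := (V.exists_mem x).choose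
  mem_baseSet_at x := (V.exists_mem x).choose_spec
  coordChange i j _ g := g * V.gen i₀ i j
  coordChange_self i _ _ g := by rw [gen_self, mul_one]
  continuousOn_coordChange i j := (continuous_of_discreteTopology.comp
    continuous_snd : Continuous ((fun g => g * V.gen i₀ i j) ∘ Prod.snd)).continuousOn
  coordChange_comp i j k x hx g := by rw [mul_assoc, V.gen_mul_gen i₀ ⟨x, hx⟩]

theorem isCoveringMap_proj : IsCoveringMap (V.bundle i₀).proj :=
  FiberBundle.isCoveringMap (F := PresentedGroup (V.nerveRelators i₀))
    (E := (V.bundle i₀).Fiber)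

/-- The point of the bundle over `x` with coordinate `g` in the chart of index `i`. -/
noncomputable def bundlePoint (i : ι) (x : X) (g : PresentedGroup (V.nerveRelators i₀)) :
    (V.bundle i₀).TotalSpace :=
  ⟨x, g * V.gen i₀ i ((V.bundle i₀).indexAt x)⟩

/-- The point `bundlePoint`, as an element of the fiber over `x`. -/
noncomputable def fiberPoint (i : ι) (x : X) (g : PresentedGroup (V.nerveRelators i₀)) :
    (V.bundle i₀).proj ⁻¹' {x} :=
  ⟨V.bundlePoint i₀ i x g, rfl⟩

theorem fiberPoint_change (hi : x ∈ V.carrier i) (hj : x ∈ V.carrier j)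
    (g : PresentedGroup (V.nerveRelators i₀)) :
    V.fiberPoint i₀ i x g = V.fiberPoint i₀ j x (g * V.gen i₀ i j) := by
  have h := V.gen_mul_gen i₀ ⟨x, ⟨hi, hj⟩, (V.bundle i₀).mem_baseSet_at x⟩
  simp only [fiberPoint, bundlePoint, mul_assoc, h]

theorem fiberPoint_injective (i : ι) (x : X) : Function.Injective (V.fiberPoint i₀ i x) := by
  intro g h e
  exact mul_right_cancel (eq_of_heq (Bundle.TotalSpace.mk.inj (congrArg Subtype.val e)).2)

/-- A path which stays in a member of the cover lifts with constant coordinate in its chart. -/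
theorem monodromy_pathClass (γ : Path x y) (hγ : ∀ t, γ t ∈ V.carrier i)
    (g : PresentedGroup (V.nerveRelators i₀)) :
    (V.isCoveringMap_proj i₀).monodromy (pathClass γ) (V.fiberPoint i₀ i x g) =
      V.fiberPoint i₀ i y g := by
  have hc : Continuous fun t => V.bundlePoint i₀ i (γ t) g :=
    ((V.bundle i₀).localTriv i).continuousOn_invFun.comp_continuous
      (γ.continuous.prodMk continuous_const) fun t =>
        ((V.bundle i₀).mem_localTriv_target i _).2 (hγ t)
  obtain ⟨f, rfl, rfl⟩ := γ
  exact (V.isCoveringMap_proj i₀).monodromy_map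
    (pathClass ⟨⟨fun t => V.bundlePoint i₀ i (f t) g, hc⟩, rfl, rfl⟩)

theorem monodromy_comp {z : X} (p : FundamentalGroupoid.mk x ⟶ FundamentalGroupoid.mk y)
    (q : FundamentalGroupoid.mk y ⟶ FundamentalGroupoid.mk z) (e : (V.bundle i₀).proj ⁻¹' {x}) :
    (V.isCoveringMap_proj i₀).monodromy (p ≫ q) e =
      (V.isCoveringMap_proj i₀).monodromy q ((V.isCoveringMap_proj i₀).monodromy p e) :=
  (V.isCoveringMap_proj i₀).monodromy_trans_apply p q e

theorem monodromy_ray (hx : x ∈ V.carrier i) (g : PresentedGroup (V.nerveRelators i₀)) :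
    (V.isCoveringMap_proj i₀).monodromy (V.ray hx) (V.fiberPoint i₀ i (V.center i) g) =
      V.fiberPoint i₀ i x g :=
  V.monodromy_pathClass i₀ (V.rayPath hx) (V.contraction_mem i x hx) g

theorem monodromy_inv_ray (hx : x ∈ V.carrier i) (g : PresentedGroup (V.nerveRelators i₀)) :
    (V.isCoveringMap_proj i₀).monodromy (inv (V.ray hx)) (V.fiberPoint i₀ i x g) =
      V.fiberPoint i₀ i (V.center i) g := by
  rw [← V.monodromy_ray i₀ hx g, ← monodromy_comp, IsIso.hom_inv_id]
  exact congrFun (V.isCoveringMap_proj i₀).monodromy_refl _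

theorem monodromy_link (i j : ι) (g : PresentedGroup (V.nerveRelators i₀)) :
    (V.isCoveringMap_proj i₀).monodromy (V.link i j) (V.fiberPoint i₀ i (V.center i) g) =
      V.fiberPoint i₀ j (V.center j) (g * V.gen i₀ i j) := by
  obtain ⟨x, hi, hj⟩ := (V.isPathConnected_inter i j).nonempty
  rw [V.link_eq hi hj, monodromy_comp, monodromy_ray, V.fiberPoint_change i₀ hi hj,
    monodromy_inv_ray]

/-- The monodromy along the image of `h` is the right translation by `h⁻¹`. -/
theorem monodromy_toFundamentalGroup (h g : PresentedGroup (V.nerveRelators i₀)) :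
    (V.isCoveringMap_proj i₀).monodromyPerm _ (V.toFundamentalGroup i₀ h)
        (V.fiberPoint i₀ i₀ (V.center i₀) g) =
      V.fiberPoint i₀ i₀ (V.center i₀) (g * h⁻¹) := by
  have hh : h ∈ Subgroup.closure (Set.range (PresentedGroup.of (rels := V.nerveRelators i₀))) := by
    rw [PresentedGroup.closure_range_of]
    trivial
  induction hh using Subgroup.closure_induction generalizing g with
  | mem h hh =>
    obtain ⟨⟨i, j⟩, rfl⟩ := hh
    change _ = V.fiberPoint i₀ i₀ (V.center i₀) (g * (V.gen i₀ i j)⁻¹)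
    have e : V.toFundamentalGroup i₀ (PresentedGroup.of (i, j)) = V.loop i₀ i j :=
      V.toFundamentalGroup_gen i₀ i j
    have e' : V.gen i₀ j i = (V.gen i₀ i j)⁻¹ := by
      obtain ⟨x, hi, hj⟩ := (V.isPathConnected_inter i j).nonempty
      rw [eq_inv_iff_mul_eq_one, V.gen_mul_gen i₀ ⟨x, ⟨hj, hi⟩, hj⟩, gen_self]
    rw [e, IsCoveringMap.coe_monodromyPerm, loop, monodromy_comp, monodromy_comp, monodromy_link,
      monodromy_link, monodromy_link, gen_base, gen_base_right, mul_one, mul_one, e']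
  | one => rw [map_one, map_one, Equiv.Perm.one_apply, inv_one, mul_one]
  | mul a b _ _ ha hb =>
    rw [map_mul, map_mul, Equiv.Perm.mul_apply, hb, ha, mul_inv_rev, mul_assoc]
  | inv a _ ha =>
    rw [map_inv, map_inv, Equiv.Perm.inv_eq_iff_eq, ha]
    simp

theorem toFundamentalGroup_injective : Function.Injective (V.toFundamentalGroup i₀) := by
  rw [injective_iff_map_eq_one]
  intro h hh
  have e := V.monodromy_toFundamentalGroup i₀ h 1
  rw [hh, map_one, Equiv.Perm.one_apply, one_mul] at e
  exact inv_eq_one.1 (V.fiberPoint_injective i₀ _ _ e).symm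

/-- The fundamental group of `X` is the edge-path group of the nerve of the cover, presented with
respect to the maximal tree of the edges from `i₀`. -/
noncomputable def fundamentalGroupEquiv :
    FundamentalGroup X (V.center i₀) ≃* PresentedGroup (V.nerveRelators i₀) :=
  (MulEquiv.ofBijective (V.toFundamentalGroup i₀)
    ⟨V.toFundamentalGroup_injective i₀, V.toFundamentalGroup_surjective⟩).symm

end ContractibleCover

namespace DimerGroup

variable {α β : Type*} {Γ : Graph α β} {A B C U K M : Set β}

/-! ### Edges of a dimer covering at a vertex -/

theorem mem_iff_eq_edgeAt (A : dimerCoverings Γ) {w : V(Γ)} {e : β} (h : Γ.Inc e w) :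
    e ∈ (A : Set β) ↔ e = edgeAt A w := by
  have hs := (A.2.existsUnique_inc w w.2).choose_spec
  refine ⟨fun he => hs.2 e ⟨he, h⟩, fun he => ?_⟩
  rw [he]
  exact hs.1.1

theorem edgeAt_inc (A : dimerCoverings Γ) (w : V(Γ)) : Γ.Inc (edgeAt A w) w :=
  (A.2.existsUnique_inc w w.2).choose_spec.1.2

theorem edgeAt_mem (A : dimerCoverings Γ) (w : V(Γ)) : edgeAt A w ∈ (A : Set β) :=
  (mem_iff_eq_edgeAt A (edgeAt_inc A w)).2 rfl

theorem edgeAt_congr {A B : dimerCoverings Γ} {w : V(Γ)}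
    (h : ∀ e, Γ.Inc e w → (e ∈ (A : Set β) ↔ e ∈ (B : Set β))) : edgeAt A w = edgeAt B w :=
  (mem_iff_eq_edgeAt B (edgeAt_inc A w)).1 ((h _ (edgeAt_inc A w)).1 (edgeAt_mem A w))

/-! ### Alternating sets of edges -/

/-- A set of edges `U` alternates with respect to `A` if at every vertex it has either no edge, or
exactly two edges, one in `A` and one outside `A`. -/
structure IsAlternating (Γ : Graph α β) (A U : Set β) : Prop where
  subset_edgeSet : U ⊆ E(Γ)
  exists_pair : ∀ e ∈ U, ∀ w, Γ.Inc e w → ∃ f g, (f ∈ U ∧ f ∈ A ∧ Γ.Inc f w) ∧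
    (g ∈ U ∧ g ∉ A ∧ Γ.Inc g w) ∧ ∀ h ∈ U, Γ.Inc h w → h = f ∨ h = g

/-- Exchanging the two edges of `U` at every vertex of `U` gives another dimer covering. -/
theorem IsAlternating.isDimerCovering (hU : IsAlternating Γ A U) (hA : IsDimerCovering Γ A) :
    IsDimerCovering Γ (U ∆ A) := by
  refine ⟨?_, fun w hw => ?_⟩
  · rintro e (he | he)
    exacts [hU.subset_edgeSet he.1, hA.subset_edgeSet he.1]
  obtain ⟨a, ⟨ha, haw⟩, ha'⟩ := hA.existsUnique_inc w hw
  by_cases hex : ∃ e ∈ U, Γ.Inc e w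
  · obtain ⟨e, he, hew⟩ := hex
    obtain ⟨f, g, hf, hg, hfg⟩ := hU.exists_pair e he w hew
    refine ⟨g, ⟨Or.inl ⟨hg.1, hg.2.1⟩, hg.2.2⟩, ?_⟩
    rintro h ⟨⟨hhU, hhA⟩ | ⟨hhA, hhU⟩, hhw⟩
    · rcases hfg h hhU hhw with rfl | rfl
      exacts [absurd hf.2.1 hhA, rfl]
    · refine absurd hf.1 ?_
      rwa [ha' f ⟨hf.2.1, hf.2.2⟩, ← ha' h ⟨hhA, hhw⟩]
  · refine ⟨a, ⟨Or.inr ⟨ha, fun h => hex ⟨a, h, haw⟩⟩, haw⟩, ?_⟩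
    rintro h ⟨⟨hhU, hhA⟩ | ⟨hhA, hhU⟩, hhw⟩
    exacts [absurd ⟨h, hhU, hhw⟩ hex, ha' h ⟨hhA, hhw⟩]

/-- `K` is a union of connected components of the set of edges `U`. -/
structure IsSaturated (Γ : Graph α β) (U K : Set β) : Prop where
  subset : K ⊆ U
  mem_of_inc : ∀ e ∈ K, ∀ f ∈ U, ∀ w, Γ.Inc e w → Γ.Inc f w → f ∈ K

theorem IsAlternating.of_isSaturated (hU : IsAlternating Γ A U) (hK : IsSaturated Γ U K) :
    IsAlternating Γ A K := by
  refine ⟨hK.subset.trans hU.subset_edgeSet, fun e he w hw => ?_⟩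
  obtain ⟨f, g, hf, hg, hfg⟩ := hU.exists_pair e (hK.subset he) w hw
  exact ⟨f, g, ⟨hK.mem_of_inc e he f hf.1 w hw hf.2.2, hf.2⟩,
    ⟨hK.mem_of_inc e he g hg.1 w hw hg.2.2, hg.2⟩, fun h hh => hfg h (hK.subset hh)⟩

/-- A finite set of pairwise disjoint edges covers twice as many vertices as it has edges. -/
theorem two_mul_ncard [Γ.Loopless] {W : Set α} (hW : W.Finite) (hM : M.Finite) (hE : M ⊆ E(Γ))
    (hMW : ∀ e ∈ M, ∀ w, Γ.Inc e w → w ∈ W) (h : ∀ w ∈ W, ∃! e, e ∈ M ∧ Γ.Inc e w) :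
    M.ncard * 2 = W.ncard := by
  classical
  rw [Set.ncard_eq_toFinset_card M hM, Set.ncard_eq_toFinset_card W hW, ← mul_one (Finset.card
    hW.toFinset)]
  refine Finset.card_mul_eq_card_mul Γ.Inc (fun e he => ?_) fun w hw => ?_
  · rw [Set.Finite.mem_toFinset] at he
    obtain ⟨x, y, hxy⟩ := Graph.exists_isLink_of_mem_edgeSet (hE he)
    rw [Finset.card_eq_two]
    refine ⟨x, y, hxy.ne, ?_⟩
    ext w
    simp only [Finset.mem_bipartiteAbove, Set.Finite.mem_toFinset, Finset.mem_insert,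
      Finset.mem_singleton]
    constructor
    · rintro ⟨-, hw⟩
      exact hw.eq_or_eq_of_isLink hxy
    · rintro (rfl | rfl)
      exacts [⟨hMW e he _ hxy.inc_left, hxy.inc_left⟩, ⟨hMW e he _ hxy.inc_right, hxy.inc_right⟩]
  · rw [Set.Finite.mem_toFinset] at hw
    obtain ⟨e, he, he'⟩ := h w hw
    rw [Finset.card_eq_one]
    refine ⟨e, ?_⟩
    ext f
    simp only [Finset.mem_bipartiteBelow, Set.Finite.mem_toFinset, Finset.mem_singleton]
    exact ⟨he' f, fun hf => hf ▸ he⟩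

/-- The edges of an alternating set which lie in `A`, and those which do not, cover the same
vertices, so there are equally many of both. -/
theorem IsAlternating.even_ncard [Γ.Loopless] (hV : V(Γ).Finite) (hE : E(Γ).Finite)
    (hK : IsAlternating Γ A K) : Even K.ncard := by
  have hfin : K.Finite := hE.subset hK.subset_edgeSet
  let W : Set α := {w | ∃ e ∈ K, Γ.Inc e w}
  have hW : W.Finite := hV.subset fun w ⟨e, _, he⟩ => he.vertex_mem
  have h₁ : (K ∩ A).ncard * 2 = W.ncard := by
    refine two_mul_ncard hW (hfin.subset Set.inter_subset_left)
      (Set.inter_subset_left.trans hK.subset_edgeSet) (fun e he w hw => ⟨e, he.1, hw⟩) ?_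
    rintro w ⟨e, he, hew⟩
    obtain ⟨f, g, hf, hg, hfg⟩ := hK.exists_pair e he w hew
    refine ⟨f, ⟨⟨hf.1, hf.2.1⟩, hf.2.2⟩, fun h ⟨⟨hh, hhA⟩, hhw⟩ => ?_⟩
    exact (hfg h hh hhw).resolve_right fun e => hg.2.1 (e ▸ hhA)
  have h₂ : (K \ A).ncard * 2 = W.ncard := by
    refine two_mul_ncard hW (hfin.subset Set.sdiff_subset)
      (Set.sdiff_subset.trans hK.subset_edgeSet) (fun e he w hw => ⟨e, he.1, hw⟩) ?_
    rintro w ⟨e, he, hew⟩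
    obtain ⟨f, g, hf, hg, hfg⟩ := hK.exists_pair e he w hew
    refine ⟨g, ⟨⟨hg.1, hg.2.1⟩, hg.2.2⟩, fun h ⟨⟨hh, hhA⟩, hhw⟩ => ?_⟩
    exact (hfg h hh hhw).resolve_left fun e => hhA (e ▸ hf.2.1)
  rw [← Set.ncard_inter_add_ncard_sdiff_eq_ncard K A hfin]
  exact ⟨(K ∩ A).ncard, by omega⟩

/-! ### Components of an alternating set -/

/-- The component of the edge `e` in the set of edges `U`. -/
def edgeComponent (Γ : Graph α β) (U : Set β) (e : β) : Set β :=
  {f | Relation.ReflTransGen (Touch Γ U) e f}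

theorem touch_comm {e f : β} (h : Touch Γ U e f) : Touch Γ U f e :=
  ⟨h.2.1, h.1, h.2.2.imp fun _ hw => ⟨hw.2, hw.1⟩⟩

theorem mem_edgeComponent_self (e : β) : e ∈ edgeComponent Γ U e := Relation.ReflTransGen.refl

theorem isSaturated_edgeComponent {e : β} (he : e ∈ U) :
    IsSaturated Γ U (edgeComponent Γ U e) := by
  have hsub : edgeComponent Γ U e ⊆ U := by
    intro f hf
    cases hf with
    | refl => exact he
    | tail _ h => exact h.2.1
  exact ⟨hsub, fun f hf g hg w hfw hgw => Relation.ReflTransGen.tail hf ⟨hsub hf, hg, w, hfw, hgw⟩⟩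

theorem edgeComponent_eq {e f : β} (h : f ∈ edgeComponent Γ U e) :
    edgeComponent Γ U f = edgeComponent Γ U e := by
  have h' : Relation.ReflTransGen (Touch Γ U) f e := by
    change Relation.ReflTransGen (Touch Γ U) e f at h
    induction h with
    | refl => exact Relation.ReflTransGen.refl
    | tail _ hbc ih => exact Relation.ReflTransGen.head (touch_comm hbc) ih
  ext g
  exact ⟨fun hg => Relation.ReflTransGen.trans h hg, fun hg => Relation.ReflTransGen.trans h' hg⟩

theorem IsAlternating.isEvenCycle_edgeComponent [Γ.Loopless] (hV : V(Γ).Finite)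
    (hE : E(Γ).Finite) (hU : IsAlternating Γ A U) {e : β} (he : e ∈ U) :
    IsEvenCycle Γ (edgeComponent Γ U e) := by
  have hs := isSaturated_edgeComponent (Γ := Γ) he
  have hK := hU.of_isSaturated hs
  refine ⟨⟨⟨hK.subset_edgeSet, hE.subset hK.subset_edgeSet, fun w _ => ?_⟩,
    ⟨e, mem_edgeComponent_self e⟩, fun f hf g hg => ?_⟩, hK.even_ncard hV hE⟩
  · by_cases hex : ∃ f ∈ edgeComponent Γ U e, Γ.Inc f w
    · obtain ⟨f, hf, hfw⟩ := hex
      obtain ⟨a, b, ha, hb, hab⟩ := hK.exists_pair f hf w hfw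
      left
      have hne : a ≠ b := fun e => hb.2.1 (e ▸ ha.2.1)
      rw [← Set.encard_pair hne]
      congr 1
      ext g
      constructor
      · exact fun hg => hab g hg.1 hg.2
      · rintro (rfl | rfl)
        exacts [⟨ha.1, ha.2.2⟩, ⟨hb.1, hb.2.2⟩]
    · right
      exact Set.eq_empty_of_forall_notMem fun f hf => hex ⟨f, hf⟩
  · rw [← edgeComponent_eq hf] at hg
    have hg' : Relation.ReflTransGen (Touch Γ U) f g := hg
    clear hg
    induction hg' with
    | refl => exact Relation.ReflTransGen.refl
    | @tail b c hb hbc ih =>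
      have hbe : b ∈ edgeComponent Γ U e := Relation.ReflTransGen.trans hf hb
      exact ih.tail ⟨hbe, Relation.ReflTransGen.tail hbe hbc, hbc.2.2⟩

/-- The set of components of the set of edges `U`. -/
def components (Γ : Graph α β) (U : Set β) : Set (Set β) := edgeComponent Γ U '' U

theorem sUnion_components_of_isSaturated (hK : IsSaturated Γ U K) :
    ⋃₀ {s ∈ components Γ U | s ⊆ K} = K := by
  ext e
  constructor
  · rintro ⟨s, ⟨-, hs⟩, he⟩
    exact hs he
  · intro he
    refine ⟨_, ⟨⟨e, hK.subset he, rfl⟩, fun f hf => ?_⟩, mem_edgeComponent_self e⟩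
    induction hf with
    | refl => exact he
    | tail _ h ih =>
      obtain ⟨-, hc, w, hw, hw'⟩ := h
      exact hK.mem_of_inc _ ih _ hc w hw hw'

theorem sUnion_components : ⋃₀ components Γ U = U := by
  refine Set.Subset.antisymm ?_ fun e he => ⟨_, ⟨e, he, rfl⟩, mem_edgeComponent_self e⟩
  rintro f ⟨_, ⟨e, he, rfl⟩, hf⟩
  exact (isSaturated_edgeComponent (Γ := Γ) he).subset hf

theorem pairwise_independent_components : (components Γ U).Pairwise (Independent Γ) := by
  rintro _ ⟨e, he, rfl⟩ _ ⟨f, hf, rfl⟩ hne a ha b hb w ⟨haw, hbw⟩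
  have hbe := (isSaturated_edgeComponent (Γ := Γ) he).mem_of_inc a ha b
    ((isSaturated_edgeComponent (Γ := Γ) hf).subset hb) w haw hbw
  exact hne ((edgeComponent_eq hbe).symm.trans (edgeComponent_eq hb))

theorem isSaturated_sUnion {T : Set (Set β)} (hT : T ⊆ components Γ U) :
    IsSaturated Γ U (⋃₀ T) := by
  refine ⟨(Set.sUnion_subset_sUnion hT).trans sUnion_components.subset, ?_⟩
  rintro e ⟨s, hs, hes⟩ f hf w hew hfw
  obtain ⟨g, hg, rfl⟩ := hT hs
  exact ⟨_, hs, (isSaturated_edgeComponent (Γ := Γ) hg).mem_of_inc e hes f hf w hew hfw⟩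

/-- The cube with base `A` whose glides are the components of a set alternating with respect
to `A`. -/
def IsAlternating.cube [Γ.Loopless] (hV : V(Γ).Finite) (hE : E(Γ).Finite)
    (hU : IsAlternating Γ A U) (hA : IsDimerCovering Γ A) : BasedCube Γ (dimerCoverings Γ) where
  base := A
  glides := components Γ U
  finite := (hE.subset hU.subset_edgeSet).image _
  isEvenCycle := by
    rintro _ ⟨e, he, rfl⟩
    exact hU.isEvenCycle_edgeComponent hV hE he
  independent := pairwise_independent_components
  vertex_mem _ hT := (hU.of_isSaturated (isSaturated_sUnion hT)).isDimerCovering hA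

/-! ### Flat triples and cubes -/

/-- `B` is a vertex of the based cube `c`. -/
def BasedCube.HasVertex {𝓔 : Set (Set β)} (c : BasedCube Γ 𝓔) (B : Set β) : Prop :=
  ∃ T ⊆ c.glides, (⋃₀ T) ∆ c.base = B

/-- At each vertex where `A`, `B`, `C` have exactly two distinct edges, these are the edges of
`A ∆ B ∪ A ∆ C`, and one of them belongs to `A`. -/
theorem IsFlat.isAlternating {A B C : dimerCoverings Γ} (h : IsFlat A B C) :
    IsAlternating Γ A ((A : Set β) ∆ B ∪ (A : Set β) ∆ C) := by
  refine ⟨?_, fun e he v hev => ?_⟩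
  · rintro e ((he | he) | (he | he))
    exacts [A.2.subset_edgeSet he.1, B.2.subset_edgeSet he.1, A.2.subset_edgeSet he.1,
      C.2.subset_edgeSet he.1]
  lift v to V(Γ) using hev.vertex_mem with w
  have key {f : β} (hf : Γ.Inc f w) : f ∈ (A : Set β) ∆ B ∪ (A : Set β) ∆ C ↔
      (f = edgeAt A w ∧ f ≠ edgeAt B w ∨ f = edgeAt B w ∧ f ≠ edgeAt A w) ∨
      (f = edgeAt A w ∧ f ≠ edgeAt C w ∨ f = edgeAt C w ∧ f ≠ edgeAt A w) := by
    simp only [Set.mem_union, Set.mem_symmDiff, mem_iff_eq_edgeAt _ hf, ne_eq]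
  have hA := edgeAt_inc A w
  have hB := edgeAt_inc B w
  have hC := edgeAt_inc C w
  have hw := h w
  by_cases hAB : edgeAt A w = edgeAt B w
  · refine ⟨edgeAt A w, edgeAt C w, ⟨(key hA).2 ?_, (mem_iff_eq_edgeAt A hA).2 rfl, hA⟩,
      ⟨(key hC).2 ?_, fun hn => ?_, hC⟩, fun f hf hfw => ?_⟩
    all_goals rw [key ‹_›] at *
    all_goals try rw [mem_iff_eq_edgeAt A hC] at hn
    all_goals grind
  · refine ⟨edgeAt A w, edgeAt B w, ⟨(key hA).2 ?_, (mem_iff_eq_edgeAt A hA).2 rfl, hA⟩,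
      ⟨(key hB).2 ?_, fun hn => ?_, hB⟩, fun f hf hfw => ?_⟩
    all_goals rw [key ‹_›] at *
    all_goals try rw [mem_iff_eq_edgeAt A hB] at hn
    all_goals grind

theorem IsFlat.isSaturated_left {A B C : dimerCoverings Γ} (h : IsFlat A B C) :
    IsSaturated Γ ((A : Set β) ∆ B ∪ (A : Set β) ∆ C) ((A : Set β) ∆ B) := by
  refine ⟨Set.subset_union_left, fun e he f hf v hev hfv => ?_⟩
  lift v to V(Γ) using hev.vertex_mem with w
  have hw := h w
  simp only [Set.mem_union, Set.mem_symmDiff, mem_iff_eq_edgeAt _ hev,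
    mem_iff_eq_edgeAt _ hfv] at *
  grind

theorem IsFlat.swap {A B C : dimerCoverings Γ} (h : IsFlat A B C) : IsFlat A C B := by
  intro w
  have := h w
  grind

/-- The dimer coverings of a flat triple are vertices of one cube. -/
theorem IsFlat.exists_cube [Γ.Loopless] (hV : V(Γ).Finite) (hE : E(Γ).Finite)
    {A B C : dimerCoverings Γ} (h : IsFlat A B C) :
    ∃ c : BasedCube Γ (dimerCoverings Γ), c.base = A ∧
      ⋃₀ c.glides = (A : Set β) ∆ B ∪ (A : Set β) ∆ C ∧ c.HasVertex B ∧ c.HasVertex C := by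
  refine ⟨h.isAlternating.cube hV hE A.2, rfl, sUnion_components,
    ⟨_, Set.sep_subset _ fun s => s ⊆ (A : Set β) ∆ B, ?_⟩,
    ⟨_, Set.sep_subset _ fun s => s ⊆ (A : Set β) ∆ C, ?_⟩⟩
  · have := h.isSaturated_left
    refine (congrArg (· ∆ (A : Set β)) (sUnion_components_of_isSaturated this)).trans ?_
    rw [symmDiff_comm (A : Set β), symmDiff_symmDiff_cancel_right]
  · have := h.swap.isSaturated_left
    rw [Set.union_comm] at this
    refine (congrArg (· ∆ (A : Set β)) (sUnion_components_of_isSaturated this)).trans ?_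
    rw [symmDiff_comm (A : Set β), symmDiff_symmDiff_cancel_right]

namespace BasedCube

variable {𝓔 : Set (Set β)} (c : BasedCube Γ 𝓔) {s : Set β} {T T' : Set (Set β)}

theorem eq_of_inc {t : Set β} (hs : s ∈ c.glides) (ht : t ∈ c.glides) {e f : β} (he : e ∈ s)
    (hf : f ∈ t) {w : α} (hew : Γ.Inc e w) (hfw : Γ.Inc f w) : s = t :=
  by_contra fun hne => c.independent hs ht hne e he f hf w ⟨hew, hfw⟩

theorem mem_sUnion_iff (hs : s ∈ c.glides) (hT : T ⊆ c.glides) {e : β} (he : e ∈ s) :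
    e ∈ ⋃₀ T ↔ s ∈ T := by
  refine ⟨fun ⟨t, ht, het⟩ => ?_, fun h => ⟨s, h, he⟩⟩
  obtain ⟨x, y, hxy⟩ := Graph.exists_isLink_of_mem_edgeSet ((c.isEvenCycle s hs).subset_edgeSet he)
  rwa [c.eq_of_inc hs (hT ht) he het hxy.inc_left hxy.inc_left]

theorem subset_sUnion_iff (hs : s ∈ c.glides) (hT : T ⊆ c.glides) : s ⊆ ⋃₀ T ↔ s ∈ T := by
  refine ⟨fun h => ?_, Set.subset_sUnion_of_mem⟩
  obtain ⟨e, he⟩ := (c.isEvenCycle s hs).nonempty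
  exact (c.mem_sUnion_iff hs hT he).1 (h he)

theorem symmDiff_subset (hT : T ⊆ c.glides) (hT' : T' ⊆ c.glides) : T ∆ T' ⊆ c.glides := by
  rintro s (h | h)
  exacts [hT h.1, hT' h.1]

theorem sUnion_symmDiff (hT : T ⊆ c.glides) (hT' : T' ⊆ c.glides) :
    ⋃₀ (T ∆ T') = (⋃₀ T) ∆ (⋃₀ T') := by
  have key {e s} (hs : s ∈ c.glides) (he : e ∈ s) :
      e ∈ ⋃₀ (T ∆ T') ↔ e ∈ (⋃₀ T) ∆ (⋃₀ T') := by
    rw [c.mem_sUnion_iff hs (c.symmDiff_subset hT hT') he, Set.mem_symmDiff, Set.mem_symmDiff,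
      c.mem_sUnion_iff hs hT he, c.mem_sUnion_iff hs hT' he]
  ext e
  constructor
  · rintro ⟨s, hs, he⟩
    exact (key (c.symmDiff_subset hT hT' hs) he).1 ⟨s, hs, he⟩
  · intro h
    obtain ⟨s, hs, he⟩ : ∃ s ∈ c.glides, e ∈ s := by
      rcases h with ⟨⟨s, hs, he⟩, -⟩ | ⟨⟨s, hs, he⟩, -⟩
      exacts [⟨s, hT hs, he⟩, ⟨s, hT' hs, he⟩]
    exact (key hs he).2 h

/-- Only one glide of a cube passes through a given vertex of the graph, and of three vertices of
the cube two agree along this glide. -/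
theorem isFlat {c : BasedCube Γ 𝓔} {A B C : dimerCoverings Γ} (hA : c.HasVertex A)
    (hB : c.HasVertex B) (hC : c.HasVertex C) : IsFlat A B C := by
  intro w
  obtain ⟨TA, hTA, hA⟩ := hA
  obtain ⟨TB, hTB, hB⟩ := hB
  obtain ⟨TC, hTC, hC⟩ := hC
  have key {T T' : Set (Set β)} {D D' : dimerCoverings Γ} (hT : T ⊆ c.glides) (hT' : T' ⊆ c.glides)
      (hD : (⋃₀ T) ∆ c.base = D) (hD' : (⋃₀ T') ∆ c.base = D')
      (h : ∀ s ∈ c.glides, (∃ e ∈ s, Γ.Inc e w) → (s ∈ T ↔ s ∈ T')) :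
      edgeAt D w = edgeAt D' w := by
    refine edgeAt_congr fun e hew => ?_
    have he : e ∈ ⋃₀ T ↔ e ∈ ⋃₀ T' := by
      by_cases hex : ∃ s ∈ c.glides, e ∈ s
      · obtain ⟨s, hs, hes⟩ := hex
        rw [c.mem_sUnion_iff hs hT hes, c.mem_sUnion_iff hs hT' hes]
        exact h s hs ⟨e, hes, hew⟩
      · exact ⟨fun ⟨s, hs, hes⟩ => absurd ⟨s, hT hs, hes⟩ hex,
          fun ⟨s, hs, hes⟩ => absurd ⟨s, hT' hs, hes⟩ hex⟩
    rw [← hD, ← hD', Set.mem_symmDiff, Set.mem_symmDiff, he]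
  by_cases hex : ∃ s ∈ c.glides, ∃ e ∈ s, Γ.Inc e w
  · obtain ⟨s, hs, e, he, hew⟩ := hex
    have huniq {t : Set β} (ht : t ∈ c.glides) (hw : ∃ f ∈ t, Γ.Inc f w) : s = t := by
      obtain ⟨f, hf, hfw⟩ := hw
      exact c.eq_of_inc hs ht he hf hew hfw
    by_cases h₁ : s ∈ TA ↔ s ∈ TB
    · exact Or.inl (key hTA hTB hA hB fun t ht hw => huniq ht hw ▸ h₁)
    by_cases h₂ : s ∈ TA ↔ s ∈ TC
    · exact Or.inr (Or.inl (key hTA hTC hA hC fun t ht hw => huniq ht hw ▸ h₂))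
    · have h₃ : s ∈ TB ↔ s ∈ TC := by tauto
      exact Or.inr (Or.inr (key hTB hTC hB hC fun t ht hw => huniq ht hw ▸ h₃))
  · exact Or.inl (key hTA hTB hA hB fun s hs hw => absurd ⟨s, hs, hw⟩ hex)

end BasedCube

/-- A cycle contained in a union of pairwise independent sets of edges does not leave the one it
meets. -/
theorem IsCycle.subset_of_independent {T : Set (Set β)} (hT : T.Pairwise (Independent Γ))
    {s t : Set β} (hs : IsCycle Γ s) (hsT : s ⊆ ⋃₀ T) (ht : t ∈ T) {e : β} (hes : e ∈ s)
    (het : e ∈ t) : s ⊆ t := by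
  intro f hf
  have h := hs.connected e hes f hf
  clear hf
  induction h with
  | refl => exact het
  | tail _ h ih =>
    obtain ⟨-, hc, w, hw, hw'⟩ := h
    obtain ⟨t', ht', hct'⟩ := hsT hc
    by_cases htt' : t = t'
    · exact htt' ▸ hct'
    · exact absurd ⟨hw, hw'⟩ (hT ht ht' htt' _ ih _ hct' w)

/-- A set of edges is in at most one way a union of pairwise independent cycles. -/
theorem subset_of_sUnion_eq {T T' : Set (Set β)} (hT : ∀ s ∈ T, IsCycle Γ s)
    (hT' : ∀ s ∈ T', IsCycle Γ s) (hi : T.Pairwise (Independent Γ))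
    (hi' : T'.Pairwise (Independent Γ)) (h : ⋃₀ T = ⋃₀ T') : T ⊆ T' := by
  intro s hs
  obtain ⟨e, he⟩ := (hT s hs).nonempty
  obtain ⟨t, ht, het⟩ : e ∈ ⋃₀ T' := h ▸ Set.mem_sUnion_of_mem he hs
  have h₁ : s ⊆ t := (hT s hs).subset_of_independent hi' (h ▸ Set.subset_sUnion_of_mem hs) ht he het
  have h₂ : t ⊆ s := (hT' t ht).subset_of_independent hi (h ▸ Set.subset_sUnion_of_mem ht) hs het he
  exact h₁.antisymm h₂ ▸ ht

end DimerGroup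

namespace DimerGroup

variable {α β : Type*} {Γ : Graph α β} {𝓔 : Set (Set β)} {A B : Set β}

/-! ### Open stars of the vertices -/

/-- The point `q` of a cube lies in the open star of the vertex `A`: the cube has the vertex
`A = [T] C`, where `C` is its base, and the coordinates of `q` are positive on `T` and less than `1`
outside `T`. -/
def InStar (A : Set β) (q : CubePoint Γ 𝓔) : Prop :=
  ∃ T ⊆ q.1.glides, (⋃₀ T) ∆ q.1.base = A ∧
    ∀ s : q.1.glides, ((s : Set β) ∈ T → 0 < q.2 s) ∧ ((s : Set β) ∉ T → q.2 s < 1)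

theorem symm_pos_of_lt_one {x : I} (hx : x < 1) : 0 < σ x := by
  rwa [← unitInterval.symm_one, unitInterval.symm_lt_symm]

theorem symm_lt_one_of_pos {x : I} (hx : 0 < x) : σ x < 1 := by
  rwa [← unitInterval.symm_zero, unitInterval.symm_lt_symm]

theorem inStar_iff_of_faceRel {p q : CubePoint Γ 𝓔} (h : FaceRel p q) :
    InStar A p ↔ InStar A q := by
  obtain ⟨hb, hg, hx, h0⟩ := h
  constructor
  · rintro ⟨T, hT, hA, hs⟩
    refine ⟨T, hT.trans hg, hb ▸ hA, fun s => ?_⟩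
    by_cases hsp : (s : Set β) ∈ p.1.glides
    · exact hx ⟨s, hsp⟩ ▸ hs ⟨s, hsp⟩
    · refine ⟨fun h => absurd (hT h) hsp, fun _ => ?_⟩
      rw [h0 s hsp]
      exact zero_lt_one
  · rintro ⟨T, hT, hA, hs⟩
    have hTp : T ⊆ p.1.glides := by
      intro s hsT
      by_contra hsp
      exact ((hs ⟨s, hT hsT⟩).1 hsT).ne' (h0 ⟨s, hT hsT⟩ hsp)
    exact ⟨T, hTp, hb ▸ hA, fun s => (hx s).symm ▸ hs ⟨s, hg s.2⟩⟩

theorem FlipRel.symm {p q : CubePoint Γ 𝓔} (h : FlipRel p q) : FlipRel q p := by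
  obtain ⟨⟨b, g, h1, h2, h3, h4⟩, x⟩ := p
  obtain ⟨⟨b', g', h1', h2', h3', h4'⟩, x'⟩ := q
  obtain ⟨T, hT, hb, hg, hx⟩ := h
  dsimp only at hT hb hg hx
  subst hg
  refine ⟨T, hT, ?_, rfl, fun s => ⟨fun hs => ?_, fun hs => ((hx s).2 hs).symm⟩⟩
  · dsimp only
    rw [hb, symmDiff_symmDiff_cancel_left]
  · exact (unitInterval.symm_symm (x s) ▸ congrArg σ ((hx s).1 hs)).symm

theorem InStar.of_flipRel {p q : CubePoint Γ 𝓔} (h : FlipRel p q) (hp : InStar A p) :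
    InStar A q := by
  obtain ⟨c, x⟩ := p
  obtain ⟨⟨b', g', h1', h2', h3', h4'⟩, x'⟩ := q
  obtain ⟨R, hR, hb, hg, hx⟩ := h
  obtain ⟨T, hT, hA, hs⟩ := hp
  dsimp only at hR hb hg hx hT hA hs
  subst hg
  refine ⟨T ∆ R, c.symmDiff_subset hT hR, ?_, fun s => ?_⟩
  · dsimp only
    rw [c.sUnion_symmDiff hT hR, hb, symmDiff_assoc, symmDiff_symmDiff_cancel_left, hA]
  · have h1 := hx s
    have h2 := hs s
    have hpos : x s < 1 → 0 < σ (x s) := symm_pos_of_lt_one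
    have hlt : 0 < x s → σ (x s) < 1 := symm_lt_one_of_pos
    dsimp only
    rw [Set.mem_symmDiff]
    by_cases hsR : (s : Set β) ∈ R <;> by_cases hsT : (s : Set β) ∈ T <;>
      simp_all

theorem inStar_iff_of_rel {p q : CubePoint Γ 𝓔} (h : FaceRel p q ∨ FlipRel p q) :
    InStar A p ↔ InStar A q :=
  h.elim inStar_iff_of_faceRel fun h => ⟨.of_flipRel h, .of_flipRel h.symm⟩

/-- The point of the cubed complex represented by a point of a cube. -/
def toComplex (q : CubePoint Γ 𝓔) : CubedComplex Γ 𝓔 := Quot.mk _ q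

theorem toComplex_eq_of_faceRel {p q : CubePoint Γ 𝓔} (h : FaceRel p q) :
    toComplex p = toComplex q :=
  Quot.sound (Or.inl h)

theorem toComplex_eq_of_flipRel {p q : CubePoint Γ 𝓔} (h : FlipRel p q) :
    toComplex p = toComplex q :=
  Quot.sound (Or.inr h)

theorem isQuotientMap_toComplex : Topology.IsQuotientMap (toComplex (Γ := Γ) (𝓔 := 𝓔)) :=
  isQuotientMap_quot_mk

variable (Γ 𝓔) in
/-- The open star of the vertex `A` in the cubed complex. -/
def openStar (A : Set β) : Set (CubedComplex Γ 𝓔) :=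
  {p | Quot.lift (InStar A) (fun _ _ h => propext (inStar_iff_of_rel h)) p}

theorem isOpen_setOf_inStar (A : Set β) : IsOpen {q : CubePoint Γ 𝓔 | InStar A q} := by
  rw [isOpen_sigma_iff]
  intro c
  have : Finite c.glides := c.finite
  have : Sigma.mk c ⁻¹' {q : CubePoint Γ 𝓔 | InStar A q} =
      ⋃ T : {T : Set (Set β) // T ⊆ c.glides ∧ (⋃₀ T) ∆ c.base = A}, ⋂ s : c.glides,
        {x : c.glides → I | ((s : Set β) ∈ T.1 → 0 < x s) ∧ ((s : Set β) ∉ T.1 → x s < 1)} := by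
    ext x
    simp [InStar, Set.mem_iUnion, Set.mem_iInter, and_assoc]
  rw [this]
  refine isOpen_iUnion fun T => isOpen_iInter_of_finite fun s => ?_
  by_cases hs : (s : Set β) ∈ T.1
  · simpa [hs] using isOpen_lt continuous_const (continuous_apply s)
  · simpa [hs] using isOpen_lt (continuous_apply s) continuous_const

theorem isOpen_openStar (A : Set β) : IsOpen (openStar Γ 𝓔 A) :=
  isQuotientMap_toComplex.isOpen_preimage.1 (isOpen_setOf_inStar A)

/-! ### Changing the base of a cube -/

/-- The same cube, with its vertex `[T] C` instead of `C` as base. -/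
def BasedCube.rebase (c : BasedCube Γ 𝓔) (T : Set (Set β)) (hT : T ⊆ c.glides) :
    BasedCube Γ 𝓔 where
  base := (⋃₀ T) ∆ c.base
  glides := c.glides
  finite := c.finite
  isEvenCycle := c.isEvenCycle
  independent := c.independent
  vertex_mem R hR := by
    rw [← symmDiff_assoc, ← c.sUnion_symmDiff hR hT]
    exact c.vertex_mem _ (c.symmDiff_subset hR hT)

/-- The points of a cube, in the coordinates of the same cube with another base. -/
theorem exists_flip (q : CubePoint Γ 𝓔) {T : Set (Set β)} (hT : T ⊆ q.1.glides) :
    ∃ x : q.1.glides → I, toComplex ⟨q.1.rebase T hT, x⟩ = toComplex q ∧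
      ∀ s : q.1.glides, ((s : Set β) ∈ T → x s = σ (q.2 s)) ∧ ((s : Set β) ∉ T → x s = q.2 s) := by
  classical
  refine ⟨fun s => if (s : Set β) ∈ T then σ (q.2 s) else q.2 s, ?_, fun s =>
    ⟨fun h => if_pos h, fun h => if_neg h⟩⟩
  refine (toComplex_eq_of_flipRel (p := q) (q := ⟨q.1.rebase T hT, _⟩)
    ⟨T, hT, rfl, rfl, fun s => ?_⟩).symm
  exact ⟨fun h => if_pos h, fun h => if_neg h⟩

/-- A point of the open star of `A` is represented by a point of a cube with base `A`. -/
theorem exists_of_mem_openStar {p : CubedComplex Γ 𝓔} (hp : p ∈ openStar Γ 𝓔 A) :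
    ∃ q : CubePoint Γ 𝓔, toComplex q = p ∧ q.1.base = A ∧ ∀ s, q.2 s < 1 := by
  obtain ⟨q, rfl⟩ := isQuotientMap_toComplex.surjective p
  obtain ⟨T, hT, hA, hs⟩ := hp
  obtain ⟨x, hx, hxs⟩ := exists_flip q hT
  refine ⟨_, hx, hA, fun s => ?_⟩
  change x s < 1
  by_cases hsT : (s : Set β) ∈ T
  · rw [(hxs s).1 hsT]
    exact symm_lt_one_of_pos ((hs s).1 hsT)
  · rw [(hxs s).2 hsT]
    exact (hs s).2 hsT

theorem exists_mem_openStar (p : CubedComplex Γ 𝓔) : ∃ A : 𝓔, p ∈ openStar Γ 𝓔 (A : Set β) := by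
  obtain ⟨q, rfl⟩ := isQuotientMap_toComplex.surjective p
  -- The vertex is reached from the base by the glides whose coordinate is exactly `1`.
  let T : Set (Set β) := {s | ∃ h : s ∈ q.1.glides, q.2 ⟨s, h⟩ = 1}
  have hT : T ⊆ q.1.glides := fun s hs => hs.1
  refine ⟨⟨_, q.1.vertex_mem T hT⟩, T, hT, rfl, fun s => ⟨?_, fun hs => ?_⟩⟩
  · rintro ⟨_, h⟩
    rw [h]
    exact zero_lt_one
  · exact lt_of_le_of_ne unitInterval.le_one' fun h => hs ⟨s.2, h⟩

/-! ### The contraction of an open star onto its center -/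

open Classical in
/-- The point dividing the segment from the vertex `A` to `q`, in a cube which has this vertex, in
the ratio `t`. The glides leading from the base of the cube to `A` are those contained in their
symmetric difference. -/
noncomputable def contract (A : Set β) (q : CubePoint Γ 𝓔) (t : I) : CubePoint Γ 𝓔 :=
  ⟨q.1, fun s => if (s : Set β) ⊆ q.1.base ∆ A then σ (t * σ (q.2 s)) else t * q.2 s⟩

theorem symmDiff_eq_of_symmDiff_eq {U C : Set β} (h : U ∆ C = A) : C ∆ A = U := by
  rw [← h, symmDiff_comm, symmDiff_symmDiff_cancel_right]

theorem BasedCube.subset_symmDiff_iff (c : BasedCube Γ 𝓔) {T : Set (Set β)} (hT : T ⊆ c.glides)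
    (hA : (⋃₀ T) ∆ c.base = A) (s : c.glides) : (s : Set β) ⊆ c.base ∆ A ↔ (s : Set β) ∈ T := by
  rw [symmDiff_eq_of_symmDiff_eq hA, c.subset_sUnion_iff s.2 hT]

/-- The coordinates of a point of a segment to `A`, where `A = [T] C` and `C` is the base. -/
theorem contract_snd {q : CubePoint Γ 𝓔} {T : Set (Set β)} (hT : T ⊆ q.1.glides)
    (hA : (⋃₀ T) ∆ q.1.base = A) (t : I) (s : q.1.glides) :
    ((s : Set β) ∈ T → (contract A q t).2 s = σ (t * σ (q.2 s))) ∧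
      ((s : Set β) ∉ T → (contract A q t).2 s = t * q.2 s) :=
  ⟨fun h => if_pos ((q.1.subset_symmDiff_iff hT hA s).2 h),
    fun h => if_neg (mt (q.1.subset_symmDiff_iff hT hA s).1 h)⟩

theorem FaceRel.contract {p q : CubePoint Γ 𝓔} (h : FaceRel p q) (hq : InStar A q) (t : I) :
    FaceRel (contract A p t) (contract A q t) := by
  obtain ⟨⟨b, g, h1, h2, h3, h4⟩, x⟩ := p
  obtain ⟨hb, hg, hx, h0⟩ := h
  obtain ⟨T, hT, hA, hs⟩ := hq
  dsimp only at hb hg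
  subst hb
  refine ⟨rfl, hg, fun s => ?_, fun s hsp => ?_⟩
  · simp only [DimerGroup.contract]
    rw [show x s = _ from hx s]
  · refine ((contract_snd hT hA t s).2 fun h => ((hs s).1 h).ne' (h0 s hsp)).trans ?_
    rw [h0 s hsp, mul_zero]

theorem FlipRel.contract {p q : CubePoint Γ 𝓔} (h : FlipRel p q) (hp : InStar A p) (t : I) :
    FlipRel (contract A p t) (contract A q t) := by
  obtain ⟨c, x⟩ := p
  obtain ⟨⟨b', g', h1', h2', h3', h4'⟩, x'⟩ := q
  obtain ⟨R, hR, hb, hg, hx⟩ := h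
  obtain ⟨T, hT, hA, hs⟩ := hp
  dsimp only at hR hb hg hx hT hA hs
  subst hg
  have hA' : (⋃₀ (T ∆ R)) ∆ b' = A := by
    rw [c.sUnion_symmDiff hT hR, hb, symmDiff_assoc, symmDiff_symmDiff_cancel_left, hA]
  refine ⟨R, hR, hb, rfl, fun s => ?_⟩
  have h₁ := contract_snd (q := ⟨c, x⟩) hT hA t s
  have h₂ := contract_snd (q := ⟨⟨b', c.glides, h1', h2', h3', h4'⟩, x'⟩)
    (c.symmDiff_subset hT hR) hA' t s
  rw [Set.mem_symmDiff] at h₂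
  refine ⟨fun hsR => ?_, fun hsR => ?_⟩ <;> by_cases hsT : (s : Set β) ∈ T
  · rw [h₁.1 hsT]
    refine (h₂.2 (by tauto)).trans ?_
    rw [unitInterval.symm_symm]
    exact congrArg (t * ·) ((hx s).1 hsR)
  · rw [h₁.2 hsT]
    refine (h₂.1 (by tauto)).trans ?_
    exact congrArg (fun y => σ (t * y))
      ((congrArg σ ((hx s).1 hsR)).trans (unitInterval.symm_symm _))
  · rw [h₁.1 hsT]
    refine (h₂.1 (by tauto)).trans ?_
    exact congrArg (fun y => σ (t * σ y)) ((hx s).2 hsR)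
  · rw [h₁.2 hsT]
    refine (h₂.2 (by tauto)).trans ?_
    exact congrArg (t * ·) ((hx s).2 hsR)

theorem inStar_contract {q : CubePoint Γ 𝓔} (hq : InStar A q) (t : I) :
    InStar A (contract A q t) := by
  obtain ⟨T, hT, hA, hs⟩ := hq
  have hlt {x : I} (hx : x < 1) : t * x < 1 := unitInterval.mul_le_right.trans_lt hx
  refine ⟨T, hT, hA, fun s => ⟨fun h => ?_, fun h => ?_⟩⟩
  · rw [(contract_snd hT hA t s).1 h]
    exact symm_pos_of_lt_one (hlt (symm_lt_one_of_pos ((hs s).1 h)))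
  · rw [(contract_snd hT hA t s).2 h]
    exact hlt ((hs s).2 h)

theorem contract_one (q : CubePoint Γ 𝓔) : contract A q 1 = q := by
  simp [contract]

theorem toComplex_contract_zero {A : 𝓔} {q : CubePoint Γ 𝓔} (hq : InStar (A : Set β) q) :
    toComplex (contract (A : Set β) q 0) = CubedComplex.vertex Γ A := by
  obtain ⟨T, hT, hA, hs⟩ := hq
  obtain ⟨x, hx, hxs⟩ := exists_flip (contract (A : Set β) q 0) (T := T) hT
  rw [← hx]
  refine (toComplex_eq_of_faceRel (p := ⟨BasedCube.point Γ A, fun s => s.2.elim⟩)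
    (q := ⟨q.1.rebase T hT, x⟩)
    ⟨hA.symm, Set.empty_subset _, fun s => s.2.elim, fun s _ => ?_⟩).symm
  change x s = 0
  by_cases hsT : (s : Set β) ∈ T
  · rw [(hxs s).1 hsT, (contract_snd hT hA 0 s).1 hsT, zero_mul, unitInterval.symm_zero,
      unitInterval.symm_one]
  · rw [(hxs s).2 hsT, (contract_snd hT hA 0 s).2 hsT, zero_mul]

/-- The trajectory of a point of a cube under the contraction. -/
noncomputable def trajectory (A : Set β) (q : CubePoint Γ 𝓔) : C(I, CubedComplex Γ 𝓔) where
  toFun t := toComplex (contract A q t)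
  continuous_toFun := by
    refine isQuotientMap_toComplex.continuous.comp (continuous_sigmaMk.comp
      (continuous_pi fun s => ?_))
    split_ifs <;> fun_prop

open Classical in
theorem continuous_trajectory (A : Set β) : Continuous (trajectory A (Γ := Γ) (𝓔 := 𝓔)) := by
  refine continuous_sigma fun c => ContinuousMap.continuous_of_continuous_uncurry _ ?_
  have h : Continuous fun p : (c.glides → I) × I => fun s : c.glides =>
      if (s : Set β) ⊆ c.base ∆ A then σ (p.2 * σ (p.1 s)) else p.2 * p.1 s := by
    refine continuous_pi fun s => ?_
    split_ifs <;> fun_prop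
  exact isQuotientMap_toComplex.continuous.comp
    ((@continuous_sigmaMk _ (fun c : BasedCube Γ 𝓔 => c.glides → I) _ c).comp h)

open Classical in
/-- The trajectory of a point of the open star of `A` under the contraction. Outside the star, where
the segments to `A` are not defined, the value is a constant path. -/
noncomputable def starTrajectory (A : Set β) : CubedComplex Γ 𝓔 → C(I, CubedComplex Γ 𝓔) :=
  fun p => Quot.liftOn p
    (fun q => if InStar A q then trajectory A q else ContinuousMap.const I p)
    fun q q' h => by
      have hiff := inStar_iff_of_rel (A := A) h
      by_cases hq : InStar A q
      · rw [if_pos hq, if_pos (hiff.1 hq)]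
        ext t
        exact Quot.sound (h.imp (fun h => h.contract (hiff.1 hq) t) fun h => h.contract hq t)
      · rw [if_neg hq, if_neg (mt hiff.2 hq)]

theorem starTrajectory_toComplex {q : CubePoint Γ 𝓔} (hq : InStar A q) :
    starTrajectory A (toComplex q) = trajectory A q :=
  if_pos hq

theorem continuousOn_starTrajectory (A : Set β) :
    ContinuousOn (starTrajectory A) (openStar Γ 𝓔 A) := by
  rw [isQuotientMap_toComplex.continuousOn_isOpen_iff (isOpen_openStar A)]
  exact (continuous_trajectory A).continuousOn.congr fun q hq => starTrajectory_toComplex hq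

end DimerGroup

namespace DimerGroup

variable {α β : Type*} {Γ : Graph α β} {𝓔 : Set (Set β)} {A B : Set β}

/-! ### Intersections of open stars -/

theorem convexComb_lt_one {x y : I} (hx : x < 1) (hy : y < 1) (t : I) :
    Set.Icc.convexComb x y t < 1 :=
  convex_Iio (1 : ℝ) (show (x : ℝ) < 1 from hx) (show (y : ℝ) < 1 from hy)
    (unitInterval.one_minus_nonneg t) (unitInterval.nonneg t) (sub_add_cancel 1 (t : ℝ))

theorem convexComb_pos {x y : I} (hx : 0 < x) (hy : 0 < y) (t : I) :
    0 < Set.Icc.convexComb x y t :=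
  convex_Ioi (0 : ℝ) (show 0 < (x : ℝ) from hx) (show 0 < (y : ℝ) from hy)
    (unitInterval.one_minus_nonneg t) (unitInterval.nonneg t) (sub_add_cancel 1 (t : ℝ))

/-- The midpoint of the unit interval. -/
noncomputable def half : I := ⟨1 / 2, by norm_num, by norm_num⟩

theorem half_pos : 0 < half := Subtype.mk_lt_mk.2 (by norm_num)

theorem half_lt_one : half < 1 := Subtype.mk_lt_mk.2 (by norm_num)

/-- The midpoint of a cube lies in the open stars of all vertices of the cube. -/
theorem BasedCube.HasVertex.inStar {c : BasedCube Γ 𝓔} (h : c.HasVertex A) :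
    InStar A (⟨c, fun _ => half⟩ : CubePoint Γ 𝓔) := by
  obtain ⟨T, hT, hA⟩ := h
  exact ⟨T, hT, hA, fun _ => ⟨fun _ => half_pos, fun _ => half_lt_one⟩⟩

theorem BasedCube.hasVertex_base (c : BasedCube Γ 𝓔) : c.HasVertex c.base :=
  ⟨∅, Set.empty_subset _, by simp⟩

theorem InStar.hasVertex {q : CubePoint Γ 𝓔} (h : InStar A q) : q.1.HasVertex A :=
  ⟨h.choose, h.choose_spec.1, h.choose_spec.2.1⟩

/-- Three open stars have a common point if and only if their centers form a flat triple. -/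
theorem nonempty_inter_openStar_iff [Γ.Loopless] (hV : V(Γ).Finite) (hE : E(Γ).Finite)
    (A B C : dimerCoverings Γ) :
    (openStar Γ (dimerCoverings Γ) (A : Set β) ∩ openStar Γ (dimerCoverings Γ) (B : Set β) ∩
      openStar Γ (dimerCoverings Γ) (C : Set β)).Nonempty ↔ IsFlat A B C := by
  constructor
  · rintro ⟨p, ⟨hA, hB⟩, hC⟩
    obtain ⟨q, rfl⟩ := isQuotientMap_toComplex.surjective p
    exact BasedCube.isFlat (InStar.hasVertex hA) (InStar.hasVertex hB) (InStar.hasVertex hC)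
  · intro h
    obtain ⟨c, hA, -, hB, hC⟩ := h.exists_cube hV hE
    exact ⟨toComplex ⟨c, fun _ => half⟩, ⟨(hA ▸ c.hasVertex_base).inStar, hB.inStar⟩, hC.inStar⟩

/-- Every point of the intersection of the open stars of `A` and `B` is joined within it to the
midpoint of the cube spanned by `A` and `B`: the cycles of this cube are the components of `A ∆ B`,
and are therefore among the glides of every cube with the vertices `A` and `B`. -/
theorem isPathConnected_inter_openStar [Γ.Loopless] (hV : V(Γ).Finite) (hE : E(Γ).Finite)
    (A B : dimerCoverings Γ) :
    IsPathConnected (openStar Γ (dimerCoverings Γ) (A : Set β) ∩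
      openStar Γ (dimerCoverings Γ) (B : Set β)) := by
  classical
  have hflat : IsFlat A B B := fun w => Or.inr (Or.inr rfl)
  obtain ⟨c, hA, hU, hB, -⟩ := hflat.exists_cube hV hE
  rw [Set.union_self] at hU
  refine ⟨toComplex ⟨c, fun _ => half⟩, ⟨(hA ▸ c.hasVertex_base).inStar, hB.inStar⟩, ?_⟩
  rintro p ⟨hpA, hpB⟩
  obtain ⟨⟨d, x⟩, rfl, hdA, hx⟩ := exists_of_mem_openStar hpA
  obtain ⟨T, hT, hTB, hs⟩ := hpB
  dsimp only at hdA hx hT hTB hs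
  have hTU : ⋃₀ c.glides = ⋃₀ T := by
    rw [hU, ← hdA]
    exact symmDiff_eq_of_symmDiff_eq hTB
  have hdT : ∀ s ∈ T, IsCycle Γ s := fun s hs => (d.isEvenCycle s (hT hs)).toIsCycle
  have hcc : ∀ s ∈ c.glides, IsCycle Γ s := fun s hs => (c.isEvenCycle s hs).toIsCycle
  have hi := d.independent.mono hT
  have hcT : c.glides = T := (subset_of_sUnion_eq hcc hdT c.independent hi hTU).antisymm
    (subset_of_sUnion_eq hdT hcc hi c.independent hTU.symm)
  -- The coordinates in the cube `d` of the midpoint of its face `c`.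
  let z : d.glides → I := fun s => if (s : Set β) ∈ T then half else 0
  have hz (s) : z s < 1 := by
    dsimp only [z]
    split_ifs
    exacts [half_lt_one, zero_lt_one]
  let γ (t : I) : CubePoint Γ (dimerCoverings Γ) :=
    ⟨d, fun s => Set.Icc.convexComb (z s) (x s) t⟩
  have hγ : Continuous fun t => toComplex (γ t) :=
    isQuotientMap_toComplex.continuous.comp
      ((@continuous_sigmaMk _ (fun c : BasedCube Γ (dimerCoverings Γ) => c.glides → I) _ d).comp
        (continuous_pi fun s => Set.Icc.continuous_convexComb (z s) (x s)))
  refine ⟨⟨⟨_, hγ⟩, ?_, ?_⟩, fun t => ⟨?_, ?_⟩⟩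
  · refine (toComplex_eq_of_faceRel (p := ⟨c, fun _ => half⟩) (q := γ 0)
      ⟨hA.trans hdA.symm, hcT.trans_subset hT, fun s => ?_, fun s h => ?_⟩).symm
    · exact ((Set.Icc.convexComb_zero _ _).trans (if_pos (hcT ▸ s.2))).symm
    · exact (Set.Icc.convexComb_zero _ _).trans (if_neg (hcT ▸ h))
  · exact congrArg toComplex (Sigma.ext rfl (heq_of_eq
      (funext fun s => Set.Icc.convexComb_one (z s) (x s))))
  · refine ⟨∅, Set.empty_subset _, ?_, fun s =>
      ⟨fun h => h.elim, fun _ => convexComb_lt_one (hz s) (hx s) t⟩⟩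
    rw [Set.sUnion_empty, ← Set.bot_eq_empty, bot_symmDiff]
    exact hdA
  · refine ⟨T, hT, hTB, fun s => ⟨fun h => ?_, fun _ => convexComb_lt_one (hz s) (hx s) t⟩⟩
    have hzs : 0 < z s := by
      dsimp only [z]
      rw [if_pos h]
      exact half_pos
    exact convexComb_pos hzs ((hs s).1 h) t

/-- The cover of the dimer complex by the open stars of its vertices. -/
noncomputable def starCover [Γ.Loopless] (hV : V(Γ).Finite) (hE : E(Γ).Finite) :
    ContractibleCover (DimerComplex Γ) (dimerCoverings Γ) where
  carrier A := openStar Γ (dimerCoverings Γ) A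
  isOpen A := isOpen_openStar (Γ := Γ) (𝓔 := dimerCoverings Γ) (A : Set β)
  exists_mem := exists_mem_openStar
  center A := CubedComplex.vertex Γ A
  contraction A := starTrajectory A
  continuousOn_contraction A :=
    continuousOn_starTrajectory (Γ := Γ) (𝓔 := dimerCoverings Γ) (A : Set β)
  contraction_zero A p hp := by
    obtain ⟨q, rfl⟩ := isQuotientMap_toComplex.surjective p
    rw [starTrajectory_toComplex hp]
    exact toComplex_contract_zero hp
  contraction_one A p hp := by
    obtain ⟨q, rfl⟩ := isQuotientMap_toComplex.surjective p
    rw [starTrajectory_toComplex hp]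
    exact congrArg toComplex (contract_one q)
  contraction_mem A p hp t := by
    obtain ⟨q, rfl⟩ := isQuotientMap_toComplex.surjective p
    rw [starTrajectory_toComplex hp]
    exact inStar_contract hp t
  isPathConnected_inter := isPathConnected_inter_openStar hV hE

theorem nerveRelators_starCover [Γ.Loopless] (hV : V(Γ).Finite) (hE : E(Γ).Finite)
    (A₀ : dimerCoverings Γ) : (starCover hV hE).nerveRelators A₀ = relators A₀ := by
  simp only [ContractibleCover.nerveRelators, relators, starCover,
    nonempty_inter_openStar_iff hV hE]

end DimerGroup

theorem mainTheorem3 {α : Type*} {β : Type*} (Γ : Graph α β) [Γ.Loopless]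
    (hV : V(Γ).Finite) (hE : E(Γ).Finite) (A₀ : DimerGroup.dimerCoverings Γ) :
    Nonempty (FundamentalGroup (DimerGroup.DimerComplex Γ) (DimerGroup.CubedComplex.vertex Γ A₀) ≃*
      PresentedGroup (DimerGroup.relators A₀)) := by
  rw [← DimerGroup.nerveRelators_starCover hV hE A₀]
  exact ⟨(DimerGroup.starCover hV hE).fundamentalGroupEquiv A₀⟩
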